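/- Let $(B,d)$ be a compact metric space, let $A_n$ ($n\ge 1$) and $A$ be nonempty compact subsets of $B$, and suppose that $A_n\to A$ in the Hausdorff metric. A *resistance form on a finite set* $V$ is a form $\mathcal E(f)=\frac12\sum_{x\neq y}c_{x,y}(f(x)-f(y))^2$ on functions $f:V\to\mathbb R$, with $c_{x,y}=c_{y,x}\in[0,\infty)$, such that $\mathcal E(f)=0$ if and only if $f$ is constant. A function $R:X\times X\to\mathbb R$ is a *resistance metric* on a set $X$ if for every finite $V\subset X$ there is a resistance form $\mathcal E_V$ on $V$ with $R(x,y)=\sup\{|f(x)-f(y)|^2/\mathcal E_V(f): f:V\to\mathbb R \text{ not constant}\}$ for all $x,y\in V$ (with $\sup\emptyset=0$). A *resistance form* on a set $X$ is a pair $(\mathcal E,\mathcal F)$ such that: (1) $\mathcal F$ is a linear space of real functions on $X$ containing the constants, and $\mathcal E$ is a nonnegative symmetric bilinear form on $\mathcal F$ with $\mathcal E(f):=\mathcal E(f,f)=0$ if and only if $f$ is constant; (2) $\mathcal F$ modulo constants, with the inner product $\mathcal E$, is a Hilbert space; (3) every real function on a finite subset of $X$ extends to an element of $\mathcal F$; (4)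 for all distinct $p,q\in X$, $\sup\{|f(p)-f(q)|^2/\mathcal E(f): f\in\mathcal F\text{ not constant}\}<\infty$; (5) if $f\in\mathcal F$, then $\bar f=\min(\max(f,0),1)\in\mathcal F$ and $\mathcal E(\bar f)\le\mathcal E(f)$. It is *associated with* $R$ if $R(p,q)=\sup\{|f(p)-f(q)|^2/\mathcal E(f): f\in\mathcal F\text{ not constant}\}$ for all $p,q\in X$. Put $\mathcal E(f)=+\infty$ for $f\notin\mathcal F$. **Theorem 2.13.** For each $n\ge1$ let $R_n$ be a resistance metric on $A_n$ that is continuous on $A_n\times A_n$ with respect to $d$, and let $R$ be a metric on $A$. Suppose that $R_n\rightarrowtail R$, that is, $R_n(x_n,y_n)\to R(x,y)$ whenever $x,y\in A$, $x_n,y_n\in A_n$ for all $n$, $x_n\to x$ and $y_n\to y$. Then $R$ is a resistance metric on $A$, and it is continuous on $A\times A$ with respect to $d$. Moreover, let $(\mathcal E_n,\mathcal F_n)$ be the resistance form on $A_n$ associated with $R_n$ for each $n\ge 1$, and let $(\mathcal E,\mathcal F)$ be the resistance form on $A$ associated with $R$. Then $(\mathcal E_n,\mathcal F_n)$ $\Gamma$-converges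 to $(\mathcal E,\mathcal F)$ on $C(B)$, that is: (a) if $f_n,f\in C(B)$ and $f_n\to f$ uniformly on $B$, then $\mathcal E(f|_A)\le\liminf_{n\to\infty}\mathcal E_n(f_n|_{A_n})$; (b) for every $f\in C(B)$ there are $f_n\in C(B)$, $n\ge1$, with $f_n\to f$ uniformly on $B$ and $\mathcal E(f|_A)=\lim_{n\to\infty}\mathcal E_n(f_n|_{A_n})$. -/

import Mathlib

open Filter Topology
open scoped ENNReal

noncomputable section

/-- The constant real-valued functions on `X`. -/
def IsConstFun {X : Type*} (f : X → ℝ) : Prop := ∃ a : ℝ, ∀ x, f x = a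

/-- `R` is a metric on the set `X`. -/
structure IsMetric {X : Type*} (R : X → X → ℝ) : Prop where
  nonneg : ∀ x y, 0 ≤ R x y
  eq_zero_iff : ∀ x y, R x y = 0 ↔ x = y
  symm : ∀ x y, R x y = R y x
  triangle : ∀ x y z, R x z ≤ R x y + R y z

/-- A resistance form on a finite set `V`: `E f = ½ ∑_{x ≠ y} c_{x,y} (f x - f y)²` with symmetric
nonnegative conductances (the diagonal terms of the double sum vanish), and `E f = 0` exactly for
the constant functions. -/
structure IsFiniteResistanceForm {V : Type*} [Fintype V] (E : (V → ℝ) → ℝ) : Prop where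
  conductances : ∃ c : V → V → ℝ, (∀ x y, c x y = c y x) ∧ (∀ x y, 0 ≤ c x y) ∧
    ∀ f : V → ℝ, E f = 1 / 2 * ∑ x, ∑ y, c x y * (f x - f y) ^ 2
  eq_zero_iff : ∀ f : V → ℝ, E f = 0 ↔ IsConstFun f

/-- `R` is a resistance metric on `X`: on each finite `V ⊆ X` it is the effective resistance of a
resistance form on `V`. The set under the supremum is always bounded above, since `V` is finite;
it is empty only if `V` has at most one point, and then the supremum is `0`. -/
def IsResistanceMetric {X : Type*} (R : X → X → ℝ) : Prop :=
  ∀ V : Finset X, ∃ E : (V → ℝ) → ℝ, IsFiniteResistanceForm E ∧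
    ∀ x y : V, R x y =
      sSup {r : ℝ | ∃ f : V → ℝ, ¬ IsConstFun f ∧ r = |f x - f y| ^ 2 / E f}

/-- Resistance forms `(ℰ, ℱ)` on a set `X`: `domain` is `ℱ` and `form` is `ℰ`. -/
structure ResistanceForm (X : Type*) where
  domain : Submodule ℝ (X → ℝ)
  form : LinearMap.BilinForm ℝ domain
  const_mem : ∀ a : ℝ, (fun _ : X => a) ∈ domain
  symm : ∀ f g : domain, form f g = form g f
  nonneg : ∀ f : domain, 0 ≤ form f f
  eq_zero_iff : ∀ f : domain, form f f = 0 ↔ IsConstFun (f : X → ℝ)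
  /-- The inner product space of classes of functions in `ℱ` modulo constants is complete:
  every `ℰ`-Cauchy sequence converges with respect to `ℰ`. -/
  complete : ∀ u : ℕ → domain,
    (∀ ε > 0, ∃ N, ∀ m ≥ N, ∀ n ≥ N, form (u m - u n) (u m - u n) < ε) →
    ∃ v : domain, Tendsto (fun n => form (u n - v) (u n - v)) atTop (𝓝 0)
  extend : ∀ (V : Finset X) (u : V → ℝ), ∃ f : domain, ∀ x : V, (f : X → ℝ) x = u x
  bounded : ∀ p q : X, p ≠ q → BddAbove {r : ℝ | ∃ f : domain, ¬ IsConstFun (f : X → ℝ) ∧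
    r = |(f : X → ℝ) p - (f : X → ℝ) q| ^ 2 / form f f}
  markov : ∀ f : domain, ∃ g : domain, (∀ x, (g : X → ℝ) x = min (max ((f : X → ℝ) x) 0) 1) ∧
    form g g ≤ form f f

namespace ResistanceForm

variable {X : Type*}

/-- `R(p, q) = sup { |f p - f q|² / ℰ(f) : f ∈ ℱ not constant }`. -/
def resistance (ℰ : ResistanceForm X) (p q : X) : ℝ :=
  sSup {r : ℝ | ∃ f : ℰ.domain, ¬ IsConstFun (f : X → ℝ) ∧
    r = |(f : X → ℝ) p - (f : X → ℝ) q| ^ 2 / ℰ.form f f}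

/-- `ℰ` is the resistance form associated with `R`: its resistance metric is `R`. -/
def IsAssociatedWith (ℰ : ResistanceForm X) (R : X → X → ℝ) : Prop :=
  ∀ p q, ℰ.resistance p q = R p q

open Classical in
/-- `ℰ(f) = ℰ(f, f)` for `f ∈ ℱ`, and `ℰ(f) = +∞` for `f ∉ ℱ`. -/
def energy (ℰ : ResistanceForm X) (f : X → ℝ) : ℝ≥0∞ :=
  if h : f ∈ ℰ.domain then ENNReal.ofReal (ℰ.form ⟨f, h⟩ ⟨f, h⟩) else ⊤

end ResistanceForm

/-- The convergence `R_n ↣ R` of functions on `A_n × A_n` to a function on `A × A`: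
`R_n(x_n, y_n) → R(x, y)` whenever `x_n, y_n ∈ A_n`, `x, y ∈ A` and `x_n → x`, `y_n → y`. -/
def ConvergesTo {B : Type*} [TopologicalSpace B] {A : ℕ → Set B} {Alim : Set B}
    (R : ∀ n, A n → A n → ℝ) (Rlim : Alim → Alim → ℝ) : Prop :=
  ∀ (x y : Alim) (xs ys : ∀ n, A n),
    Tendsto (fun n => (xs n : B)) atTop (𝓝 (x : B)) →
    Tendsto (fun n => (ys n : B)) atTop (𝓝 (y : B)) →
    Tendsto (fun n => R n (xs n) (ys n)) atTop (𝓝 (Rlim x y))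

/-- `Γ`-convergence on `C(B)` of functionals `E_n` on `C(A_n)` to a functional `Elim` on `C(A)`;
`‖·‖` is the supremum norm of `C(B)`. -/
structure GammaConverges {B : Type*} [TopologicalSpace B] [CompactSpace B]
    {A : ℕ → Set B} {Alim : Set B}
    (E : ∀ n, C(A n, ℝ) → ℝ≥0∞) (Elim : C(Alim, ℝ) → ℝ≥0∞) : Prop where
  liminf_le : ∀ (f : ℕ → C(B, ℝ)) (flim : C(B, ℝ)),
    Tendsto (fun n => ‖f n - flim‖) atTop (𝓝 0) →
    Elim (flim.restrict Alim) ≤ liminf (fun n => E n ((f n).restrict (A n))) atTop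
  recovery : ∀ flim : C(B, ℝ), ∃ f : ℕ → C(B, ℝ),
    Tendsto (fun n => ‖f n - flim‖) atTop (𝓝 0) ∧
    Tendsto (fun n => E n ((f n).restrict (A n))) atTop (𝓝 (Elim (flim.restrict Alim)))

end

noncomputable section

section FiniteNetworks

variable {V : Type*} [Fintype V]

/-- The Dirichlet energy of `f` on the network with conductances `c`. -/
def dirichlet (c : V → V → ℝ) (f : V → ℝ) : ℝ :=
  1 / 2 * ∑ x, ∑ y, c x y * (f x - f y) ^ 2

/-- `ρ` is the effective resistance of the network with conductances `c`. -/
structure IsEffectiveResistance (c ρ : V → V → ℝ) : Prop where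
  symm : ∀ x y, c x y = c y x
  nonneg : ∀ x y, 0 ≤ c x y
  diag : ∀ x, c x x = 0
  diag_resistance : ∀ x, ρ x x = 0
  sq_le : ∀ (f : V → ℝ) (x y : V), (f x - f y) ^ 2 ≤ ρ x y * dirichlet c f
  approx : ∀ (x y : V), ∀ ε > 0, ∃ f : V → ℝ, dirichlet c f ≤ 1 ∧ ρ x y - ε ≤ (f x - f y) ^ 2

lemma dirichlet_nonneg {c : V → V → ℝ} (hc : ∀ x y, 0 ≤ c x y) (f : V → ℝ) :
    0 ≤ dirichlet c f := by
  unfold dirichlet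
  have : 0 ≤ ∑ x, ∑ y, c x y * (f x - f y) ^ 2 :=
    Finset.sum_nonneg fun x _ => Finset.sum_nonneg fun y _ => mul_nonneg (hc x y) (sq_nonneg _)
  positivity

lemma dirichlet_eq_zero_of_isConstFun (c : V → V → ℝ) {f : V → ℝ} (hf : IsConstFun f) :
    dirichlet c f = 0 := by
  obtain ⟨a, ha⟩ := hf
  simp [dirichlet, ha]

lemma dirichlet_mul (c : V → V → ℝ) (f : V → ℝ) (t : ℝ) :
    dirichlet c (fun x => t * f x) = t ^ 2 * dirichlet c f := by
  simp only [dirichlet, Finset.mul_sum]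
  exact Finset.sum_congr rfl fun x _ => Finset.sum_congr rfl fun y _ => by ring

lemma dirichlet_sub_const (c : V → V → ℝ) (f : V → ℝ) (a : ℝ) :
    dirichlet c (fun x => f x - a) = dirichlet c f := by
  simp [dirichlet]

lemma mul_sq_le_dirichlet {c : V → V → ℝ} (hc : ∀ x y, 0 ≤ c x y) (f : V → ℝ) (x y : V) :
    c x y * (f x - f y) ^ 2 ≤ 2 * dirichlet c f := by
  have h1 : c x y * (f x - f y) ^ 2 ≤ ∑ y, c x y * (f x - f y) ^ 2 :=
    Finset.single_le_sum (f := fun y => c x y * (f x - f y) ^ 2)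
      (fun y _ => mul_nonneg (hc x y) (sq_nonneg _)) (Finset.mem_univ y)
  have h2 : ∑ y, c x y * (f x - f y) ^ 2 ≤ ∑ x, ∑ y, c x y * (f x - f y) ^ 2 :=
    Finset.single_le_sum (f := fun x => ∑ y, c x y * (f x - f y) ^ 2)
      (fun x _ => Finset.sum_nonneg fun y _ => mul_nonneg (hc x y) (sq_nonneg _))
      (Finset.mem_univ x)
  unfold dirichlet
  linarith

lemma tendsto_dirichlet {ι : Type*} {l : Filter ι} {c : ι → V → V → ℝ} {c' : V → V → ℝ}
    {f : ι → V → ℝ} {f' : V → ℝ} (hc : Tendsto c l (𝓝 c')) (hf : Tendsto f l (𝓝 f')) :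
    Tendsto (fun i => dirichlet (c i) (f i)) l (𝓝 (dirichlet c' f')) := by
  have hc' : ∀ x y, Tendsto (fun i => c i x y) l (𝓝 (c' x y)) := fun x y =>
    tendsto_pi_nhds.1 (tendsto_pi_nhds.1 hc x) y
  have hf' : ∀ x, Tendsto (fun i => f i x) l (𝓝 (f' x)) := tendsto_pi_nhds.1 hf
  exact (tendsto_finsetSum _ fun x _ => tendsto_finsetSum _ fun y _ =>
    (hc' x y).mul (((hf' x).sub (hf' y)).pow 2)).const_mul _

lemma IsEffectiveResistance.mul_le_two {c ρ : V → V → ℝ} (h : IsEffectiveResistance c ρ)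
    (x y : V) : c x y * ρ x y ≤ 2 := by
  refine le_of_forall_pos_le_add fun ε hε => ?_
  have hc := h.nonneg x y
  obtain ⟨f, hf1, hf⟩ := h.approx x y (ε / (c x y + 1)) (by positivity)
  have h1 := mul_sq_le_dirichlet h.nonneg f x y
  have h2 : c x y * (ρ x y - ε / (c x y + 1)) ≤ c x y * (f x - f y) ^ 2 :=
    mul_le_mul_of_nonneg_left hf hc
  have h3 : c x y * (ε / (c x y + 1)) ≤ ε := by
    rw [mul_div_assoc', div_le_iff₀ (by positivity)]
    nlinarith
  nlinarith

/-- A finite set of points at positive distances in a set with a resistance metric carries a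
network whose effective resistance is the restricted metric. -/
lemma IsResistanceMetric.exists_conductances {X : Type*} {R : X → X → ℝ}
    (hR : IsResistanceMetric R) (φ : V → X) (hφ : Function.Injective φ)
    (hpos : ∀ x y, x ≠ y → 0 < R (φ x) (φ y)) :
    ∃ c : V → V → ℝ, IsEffectiveResistance c fun x y => R (φ x) (φ y) := by
  classical
  obtain ⟨E, ⟨⟨c, hsymm, hnonneg, hE⟩, hE0⟩, hRE⟩ := hR (Finset.univ.map ⟨φ, hφ⟩)
  let e : V ≃ (Finset.univ.map ⟨φ, hφ⟩ : Finset X) := Equiv.ofBijective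
    (fun v => ⟨φ v, Finset.mem_map_of_mem ⟨φ, hφ⟩ (Finset.mem_univ v)⟩) ⟨fun a b hab => by
      exact hφ (congrArg Subtype.val hab), fun ⟨b, hb⟩ => by
      obtain ⟨a, _, rfl⟩ := Finset.mem_map.1 hb
      exact ⟨a, rfl⟩⟩
  have he : ∀ v, (e v : X) = φ v := fun v => rfl
  let c' : V → V → ℝ := fun x y => if x = y then 0 else c (e x) (e y)
  have hEc : ∀ f, E f = dirichlet c' (fun v => f (e v)) := by
    intro f
    rw [hE, dirichlet, ← Equiv.sum_comp e]
    congr 1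
    refine Finset.sum_congr rfl fun x _ => ?_
    rw [← Equiv.sum_comp e]
    refine Finset.sum_congr rfl fun y _ => ?_
    by_cases h : x = y
    · subst h; simp
    · simp [c', h]
  have hc' : ∀ x y, 0 ≤ c' x y := fun x y => by
    by_cases h : x = y
    · simp [c', h]
    · simpa [c', h] using hnonneg _ _
  have hE_nonneg : ∀ f, 0 ≤ E f := fun f => by
    rw [hEc]; exact dirichlet_nonneg hc' _
  have hE_pos : ∀ f, ¬ IsConstFun f → 0 < E f := fun f hf =>
    lt_of_le_of_ne (hE_nonneg f) fun h => hf ((hE0 f).1 h.symm)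
  have hdiag : ∀ x, R (φ x) (φ x) = 0 := by
    intro x
    rw [← he, hRE]
    refine le_antisymm (Real.sSup_le ?_ le_rfl) (Real.sSup_nonneg ?_)
    · rintro r ⟨f, -, rfl⟩; simp
    · rintro r ⟨f, -, rfl⟩; simp
  have hext : ∀ f : V → ℝ, dirichlet c' f = E (fun v => f (e.symm v)) := fun f => by
    rw [hEc]; simp
  refine ⟨c', ⟨fun x y => ?_, hc', fun x => by simp [c'], hdiag, fun f x y => ?_,
    fun x y ε hε => ?_⟩⟩
  · by_cases h : x = y
    · simp [h]
    · simp [c', h, Ne.symm h, hsymm (e x)]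
  · by_cases hxy : x = y
    · subst hxy; simp [hdiag]
    rw [hext]
    set g : (Finset.univ.map ⟨φ, hφ⟩ : Finset X) → ℝ := fun v => f (e.symm v) with hg
    have hgx : ∀ v, f v = g (e v) := fun v => by simp [hg]
    rw [hgx x, hgx y]
    by_cases hconst : IsConstFun g
    · rw [(hE0 g).2 hconst]
      obtain ⟨a, ha⟩ := hconst
      simp [ha]
    have hp := hpos x y hxy
    rw [← he, ← he, hRE] at hp ⊢
    have hb : BddAbove {r : ℝ | ∃ f, ¬ IsConstFun f ∧ r = |f (e x) - f (e y)| ^ 2 / E f} := by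
      by_contra hb
      rw [Real.sSup_of_not_bddAbove hb] at hp
      exact hp.false
    have := le_csSup hb ⟨g, hconst, rfl⟩
    rwa [div_le_iff₀ (hE_pos g hconst), sq_abs] at this
  · by_cases hle : R (φ x) (φ y) - ε ≤ 0
    · refine ⟨0, ?_, ?_⟩
      · exact (dirichlet_eq_zero_of_isConstFun c' ⟨0, fun _ => rfl⟩).trans_le zero_le_one
      · simpa using hle
    push Not at hle
    have hp : R (φ x) (φ y) - ε < R (φ x) (φ y) := by linarith
    have hne : {r : ℝ | ∃ f, ¬ IsConstFun f ∧ r = |f (e x) - f (e y)| ^ 2 / E f}.Nonempty := by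
      by_contra hne
      rw [Set.not_nonempty_iff_eq_empty] at hne
      have : R (φ x) (φ y) = 0 := by rw [← he, ← he, hRE, hne, Real.sSup_empty]
      linarith
    have hlt : R (φ x) (φ y) - ε < sSup {r : ℝ | ∃ f, ¬ IsConstFun f ∧
        r = |f (e x) - f (e y)| ^ 2 / E f} := by
      rw [← hRE]; exact hp
    obtain ⟨r, ⟨f, hf, rfl⟩, hr⟩ := exists_lt_of_lt_csSup hne hlt
    have hEf := hE_pos f hf
    refine ⟨fun v => (Real.sqrt (E f))⁻¹ * f (e v), ?_, ?_⟩
    · rw [dirichlet_mul, ← hEc, inv_pow, Real.sq_sqrt hEf.le, inv_mul_cancel₀ hEf.ne']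
    · rw [← mul_sub, mul_pow, inv_pow, Real.sq_sqrt hEf.le]
      rw [sq_abs, div_eq_inv_mul] at hr
      exact hr.le

lemma IsEffectiveResistance.exists_form {c ρ : V → V → ℝ} (h : IsEffectiveResistance c ρ) :
    IsFiniteResistanceForm (dirichlet c) ∧ ∀ x y,
      ρ x y = sSup {r : ℝ | ∃ f : V → ℝ, ¬ IsConstFun f ∧
        r = |f x - f y| ^ 2 / dirichlet c f} := by
  have hzero : ∀ f, dirichlet c f = 0 ↔ IsConstFun f := by
    refine fun f => ⟨fun hf => ?_, dirichlet_eq_zero_of_isConstFun c⟩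
    rcases isEmpty_or_nonempty V with hV | ⟨⟨o⟩⟩
    · exact ⟨0, fun x => isEmptyElim x⟩
    · refine ⟨f o, fun x => ?_⟩
      have := h.sq_le f x o
      rw [hf, mul_zero] at this
      nlinarith [pow_eq_zero_iff (two_ne_zero) |>.1 (le_antisymm this (sq_nonneg _))]
  have hpos : ∀ f, ¬ IsConstFun f → 0 < dirichlet c f := fun f hf =>
    lt_of_le_of_ne (dirichlet_nonneg h.nonneg f) fun h => hf ((hzero f).1 h.symm)
  refine ⟨⟨⟨c, h.symm, h.nonneg, fun f => rfl⟩, hzero⟩, fun x y => ?_⟩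
  have hub : ∀ r ∈ {r : ℝ | ∃ f : V → ℝ, ¬ IsConstFun f ∧
        r = |f x - f y| ^ 2 / dirichlet c f}, r ≤ ρ x y := by
    rintro r ⟨f, hf, rfl⟩
    rw [div_le_iff₀ (hpos f hf), sq_abs]
    exact h.sq_le f x y
  have hnn : 0 ≤ sSup {r : ℝ | ∃ f : V → ℝ, ¬ IsConstFun f ∧
        r = |f x - f y| ^ 2 / dirichlet c f} := by
    refine Real.sSup_nonneg ?_
    rintro r ⟨f, hf, rfl⟩
    have := hpos f hf
    positivity
  refine le_antisymm (le_of_forall_pos_le_add fun ε hε => ?_) (Real.sSup_le hub ?_)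
  · by_cases hle : ρ x y - ε ≤ 0
    · linarith
    obtain ⟨f, hf1, hf⟩ := h.approx x y ε hε
    have hf' : ¬ IsConstFun f := by
      rintro ⟨a, ha⟩
      simp only [ha, sub_self] at hf
      apply hle
      simpa using hf
    have h1 := le_csSup ⟨_, hub⟩ ⟨f, hf', rfl⟩
    have h2 : (f x - f y) ^ 2 ≤ |f x - f y| ^ 2 / dirichlet c f := by
      rw [sq_abs, le_div_iff₀ (hpos f hf')]
      nlinarith [sq_nonneg (f x - f y)]
    linarith
  · by_cases hxy : x = y
    · rw [hxy, h.diag_resistance]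
    · classical
      have := h.sq_le (fun v => if v = x then 1 else 0) x y
      simp only [if_true, Ne.symm hxy, if_false] at this
      have h0 := dirichlet_nonneg h.nonneg (fun v => if v = x then (1 : ℝ) else 0)
      by_contra hneg
      nlinarith

/-- Limits of effective resistances are effective resistances, as long as distinct points stay
at positive resistance. -/
lemma exists_isEffectiveResistance_of_tendsto {c ρ : ℕ → V → V → ℝ} {ρ' : V → V → ℝ}
    (h : ∀ᶠ n in atTop, IsEffectiveResistance (c n) (ρ n))
    (hρ : ∀ x y, Tendsto (fun n => ρ n x y) atTop (𝓝 (ρ' x y)))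
    (hpos : ∀ x y, x ≠ y → 0 < ρ' x y) :
    ∃ c', IsEffectiveResistance c' ρ' := by
  have hbound : ∀ᶠ n in atTop, c n ∈ Set.pi Set.univ fun x => Set.pi Set.univ fun y =>
      Set.Icc 0 (4 / ρ' x y) := by
    have h1 : ∀ᶠ n in atTop, ∀ x y, x ≠ y → ρ' x y / 2 < ρ n x y := by
      refine eventually_all.2 fun x => eventually_all.2 fun y => ?_
      by_cases hxy : x = y
      · exact Eventually.of_forall fun n h => absurd hxy h
      · filter_upwards [(hρ x y).eventually_const_lt (half_lt_self (hpos x y hxy))] with n hn _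
        exact hn
    filter_upwards [h, h1] with n hn hn1 x _ y _
    refine ⟨hn.nonneg x y, ?_⟩
    by_cases hxy : x = y
    · subst hxy
      have h0 : ρ' x x = 0 := tendsto_nhds_unique_of_eventuallyEq (hρ x x) tendsto_const_nhds
        (h.mono fun n hn => hn.diag_resistance x)
      rw [hn.diag, h0, div_zero]
    · have hp := hpos x y hxy
      rw [le_div_iff₀ hp]
      have := hn.mul_le_two x y
      nlinarith [hn1 x y hxy, hn.nonneg x y]
  obtain ⟨c', -, σ, hσ, hc'⟩ := (isCompact_univ_pi fun x => isCompact_univ_pi fun y =>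
    isCompact_Icc).tendsto_subseq' hbound.frequently
  have hσ' := hσ.tendsto_atTop
  have hev := hσ'.eventually h
  have hcc : ∀ x y, Tendsto (fun k => c (σ k) x y) atTop (𝓝 (c' x y)) := fun x y =>
    tendsto_pi_nhds.1 (tendsto_pi_nhds.1 hc' x) y
  refine ⟨c', ⟨fun x y => ?_, fun x y => ?_, fun x => ?_, fun x => ?_, fun f x y => ?_,
    fun x y ε hε => ?_⟩⟩
  · exact tendsto_nhds_unique_of_eventuallyEq (hcc x y) (hcc y x)
      (hev.mono fun k hk => hk.symm x y)
  · exact ge_of_tendsto (hcc x y) (hev.mono fun k hk => hk.nonneg x y)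
  · exact tendsto_nhds_unique_of_eventuallyEq (hcc x x) tendsto_const_nhds
      (hev.mono fun k hk => hk.diag x)
  · exact tendsto_nhds_unique_of_eventuallyEq (hρ x x) tendsto_const_nhds
      (h.mono fun k hk => hk.diag_resistance x)
  · exact ge_of_tendsto (((hρ x y).comp hσ').mul (tendsto_dirichlet hc' tendsto_const_nhds))
      (hev.mono fun k hk => hk.sq_le f x y)
  · have hf : ∀ k, ∃ f : V → ℝ, IsEffectiveResistance (c (σ k)) (ρ (σ k)) →
        dirichlet (c (σ k)) f ≤ 1 ∧ ρ (σ k) x y - ε ≤ (f x - f y) ^ 2 ∧ f y = 0 := by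
      intro k
      by_cases hk : IsEffectiveResistance (c (σ k)) (ρ (σ k))
      · obtain ⟨f, hf1, hf⟩ := hk.approx x y ε hε
        refine ⟨fun v => f v - f y, fun _ => ⟨?_, ?_, sub_self _⟩⟩
        · rwa [dirichlet_sub_const]
        · simpa using hf
      · exact ⟨0, fun h => absurd h hk⟩
    choose f hf using hf
    have hfb : ∀ᶠ k in atTop, f k ∈ Set.pi Set.univ fun z =>
        Set.Icc (-(ρ' z y + 2)) (ρ' z y + 2) := by
      have h1 : ∀ᶠ k in atTop, ∀ z, ρ (σ k) z y < ρ' z y + 1 :=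
        eventually_all.2 fun z => ((hρ z y).comp hσ').eventually_lt_const (lt_add_one _)
      filter_upwards [hev, h1] with k hk hk1 z _
      obtain ⟨hd, -, h0⟩ := hf k hk
      have h2 := hk.sq_le (f k) z y
      rw [h0, sub_zero] at h2
      have h3 := dirichlet_nonneg hk.nonneg (f k)
      have h4 := hk1 z
      have h5 : f k z ^ 2 ≤ max (ρ (σ k) z y) 0 := by
        rcases le_total 0 (ρ (σ k) z y) with h | h
        · rw [max_eq_left h]; nlinarith
        · rw [max_eq_right h]; nlinarith
      have h6 : f k z ^ 2 ≤ ρ' z y + 1 := by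
        refine h5.trans (max_le h4.le ?_)
        by_cases hzy : z = y
        · have := hk.diag_resistance y
          rw [hzy] at h4 ⊢; linarith
        · linarith [hpos z y hzy]
      constructor <;> nlinarith [sq_nonneg (f k z - 1), sq_nonneg (f k z + 1)]
    obtain ⟨f', -, τ, hτ, hf'⟩ := (isCompact_univ_pi fun z =>
      isCompact_Icc).tendsto_subseq' hfb.frequently
    have hτ' := hτ.tendsto_atTop
    have hff : ∀ x, Tendsto (fun k => f (τ k) x) atTop (𝓝 (f' x)) := tendsto_pi_nhds.1 hf'
    refine ⟨f', ?_, ?_⟩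
    · exact le_of_tendsto (tendsto_dirichlet (hc'.comp hτ') hf')
        ((hτ'.eventually hev).mono fun k hk => (hf _ hk).1)
    · exact le_of_tendsto_of_tendsto
        (((hρ x y).comp (hσ'.comp hτ')).sub_const ε) (((hff x).sub (hff y)).pow 2)
        ((hτ'.eventually hev).mono fun k hk => (hf _ hk).2.1)

end FiniteNetworks

section GreenKernel

variable {X : Type*}

/-- The Green kernel of the resistance metric `ρ` killed at `o`. -/
def greenKernel (ρ : X → X → ℝ) (o x y : X) : ℝ := (ρ x o + ρ y o - ρ x y) / 2

end GreenKernel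

namespace ResistanceForm

variable {X : Type*} (ℰ : ResistanceForm X) (o : X)

/-- The functions of finite energy that vanish at `o`, as a subspace of the domain. -/
def pinned : Submodule ℝ ℰ.domain where
  carrier := {f | (f : X → ℝ) o = 0}
  add_mem' {f g} hf hg := by
    simp only [Set.mem_ofPred_eq] at hf hg
    simp [hf, hg]
  zero_mem' := rfl
  smul_mem' a f hf := by
    simp only [Set.mem_ofPred_eq] at hf
    simp [hf]

/-- The functions of finite energy that vanish at `o`, as a Hilbert space with the energy inner
product. -/
def Pinned : Type _ := ↥(ℰ.pinned o)

instance : AddCommGroup (ℰ.Pinned o) := inferInstanceAs (AddCommGroup (ℰ.pinned o))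

instance : Module ℝ (ℰ.Pinned o) := inferInstanceAs (Module ℝ (ℰ.pinned o))

namespace Pinned

/-- The inclusion of the pinned functions in the domain. -/
def toDomain : ℰ.Pinned o →ₗ[ℝ] ℰ.domain := (ℰ.pinned o).subtype

/-- Evaluation of pinned functions at `x`. -/
def eval (x : X) : ℰ.Pinned o →ₗ[ℝ] ℝ :=
  LinearMap.proj x ∘ₗ ℰ.domain.subtype ∘ₗ toDomain ℰ o

variable {ℰ o}

lemma eval_base (f : ℰ.Pinned o) : eval ℰ o o f = 0 := f.2

lemma ext_eval {f g : ℰ.Pinned o} (h : ∀ x, eval ℰ o x f = eval ℰ o x g) : f = g :=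
  Subtype.ext (Subtype.ext (funext h))

variable (ℰ o) in
/-- The energy as an inner product on pinned functions. -/
@[reducible]
def core : InnerProductSpace.Core ℝ (ℰ.Pinned o) where
  inner f g := ℰ.form (toDomain ℰ o f) (toDomain ℰ o g)
  conj_inner_symm f g := ℰ.symm _ _
  re_inner_nonneg f := ℰ.nonneg _
  add_left f g h := by simp
  smul_left f g r := by simp
  definite f hf := by
    obtain ⟨a, ha⟩ := (ℰ.eq_zero_iff _).1 hf
    have h0 := (ha o).symm.trans (eval_base f)
    refine ext_eval fun x => ?_
    rw [map_zero]
    exact (ha x).trans h0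

instance : NormedAddCommGroup (ℰ.Pinned o) := (core ℰ o).toNormedAddCommGroup

instance : InnerProductSpace ℝ (ℰ.Pinned o) := InnerProductSpace.ofCore (core ℰ o).toCore

lemma inner_eq (f g : ℰ.Pinned o) :
    inner ℝ f g = ℰ.form (toDomain ℰ o f) (toDomain ℰ o g) := rfl

lemma norm_sq_eq (f : ℰ.Pinned o) : ‖f‖ ^ 2 = ℰ.form (toDomain ℰ o f) (toDomain ℰ o f) := by
  rw [← real_inner_self_eq_norm_sq, inner_eq]

end Pinned

/-- The energy does not see constants. -/
lemma form_const_left (a : ℝ) (f : ℰ.domain) : ℰ.form ⟨fun _ => a, ℰ.const_mem a⟩ f = 0 := by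
  set u : ℰ.domain := ⟨fun _ => a, ℰ.const_mem a⟩
  have hu : ℰ.form u u = 0 := (ℰ.eq_zero_iff u).2 ⟨a, fun _ => rfl⟩
  have key : ∀ t : ℝ, 0 ≤ 2 * t * ℰ.form u f + ℰ.form f f := by
    intro t
    have := ℰ.nonneg (t • u + f)
    simp only [map_add, map_smul, LinearMap.add_apply, LinearMap.smul_apply, smul_eq_mul, hu,
      ℰ.symm f u] at this
    linarith
  by_contra hne
  have := key (-(ℰ.form f f + 1) / (2 * ℰ.form u f))
  rw [show 2 * (-(ℰ.form f f + 1) / (2 * ℰ.form u f)) * ℰ.form u f = -(ℰ.form f f + 1) by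
    field_simp] at this
  linarith

lemma form_sub_const (a : ℝ) (f : ℰ.domain) :
    ℰ.form (f - ⟨fun _ => a, ℰ.const_mem a⟩) (f - ⟨fun _ => a, ℰ.const_mem a⟩) =
      ℰ.form f f := by
  simp only [map_sub, LinearMap.sub_apply, form_const_left, ℰ.symm f ⟨fun _ => a, ℰ.const_mem a⟩]
  ring

/-- The pinned representative of a function of finite energy modulo constants. -/
def pin (f : ℰ.domain) : ℰ.Pinned o :=
  ⟨f - ⟨fun _ => (f : X → ℝ) o, ℰ.const_mem _⟩, sub_self ((f : X → ℝ) o)⟩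

variable {o}

lemma eval_pin (f : ℰ.domain) (x : X) :
    Pinned.eval ℰ o x (ℰ.pin o f) = (f : X → ℝ) x - (f : X → ℝ) o := rfl

lemma norm_sq_pin (f : ℰ.domain) : ‖ℰ.pin o f‖ ^ 2 = ℰ.form f f := by
  rw [Pinned.norm_sq_eq]
  exact ℰ.form_sub_const _ f

instance : CompleteSpace (ℰ.Pinned o) := by
  refine Metric.complete_of_cauchySeq_tendsto fun u hu => ?_
  obtain ⟨v, hv⟩ := ℰ.complete (fun n => Pinned.toDomain ℰ o (u n)) fun ε hε => by
    obtain ⟨N, hN⟩ := Metric.cauchySeq_iff.1 hu (√ε) (Real.sqrt_pos.2 hε)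
    refine ⟨N, fun m hm n hn => ?_⟩
    have h := hN m hm n hn
    rw [dist_eq_norm] at h
    rw [← map_sub, ← Pinned.norm_sq_eq]
    exact (Real.lt_sqrt (norm_nonneg _)).1 h
  refine ⟨ℰ.pin o v, ?_⟩
  rw [tendsto_iff_norm_sub_tendsto_zero]
  have h2 : ∀ n, u n - ℰ.pin o v = ℰ.pin o (Pinned.toDomain ℰ o (u n) - v) := fun n =>
    Pinned.ext_eval fun x => by
      have h0 := Pinned.eval_base (u n)
      rw [map_sub, eval_pin, eval_pin]
      change _ = (Pinned.eval ℰ o x (u n) - (v : X → ℝ) x) -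
        (Pinned.eval ℰ o o (u n) - (v : X → ℝ) o)
      rw [h0]; ring
  have h3 : ∀ n, ‖u n - ℰ.pin o v‖ = √(ℰ.form (Pinned.toDomain ℰ o (u n) - v)
      (Pinned.toDomain ℰ o (u n) - v)) := fun n => by
    rw [h2, ← norm_sq_pin (o := o), Real.sqrt_sq (norm_nonneg _)]
  simp only [h3]
  simpa using hv.sqrt

lemma resistance_self (p : X) : ℰ.resistance p p = 0 := by
  refine le_antisymm (Real.sSup_le ?_ le_rfl) (Real.sSup_nonneg ?_)
  · rintro r ⟨f, -, rfl⟩; simp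
  · rintro r ⟨f, -, rfl⟩; simp

lemma form_pos {f : ℰ.domain} (hf : ¬ IsConstFun (f : X → ℝ)) : 0 < ℰ.form f f :=
  lt_of_le_of_ne (ℰ.nonneg f) fun h => hf ((ℰ.eq_zero_iff f).1 h.symm)

/-- The fundamental estimate of functions by their energy. -/
lemma sq_sub_le (f : ℰ.domain) (p q : X) :
    ((f : X → ℝ) p - (f : X → ℝ) q) ^ 2 ≤ ℰ.resistance p q * ℰ.form f f := by
  by_cases hpq : p = q
  · simp [hpq, resistance_self]
  by_cases hf : IsConstFun (f : X → ℝ)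
  · rw [(ℰ.eq_zero_iff f).2 hf]
    obtain ⟨a, ha⟩ := hf
    simp [ha]
  have := le_csSup (ℰ.bounded p q hpq) ⟨f, hf, rfl⟩
  rwa [div_le_iff₀ (ℰ.form_pos hf), sq_abs] at this

namespace Pinned

variable {ℰ}

lemma resistance_nonneg (p q : X) : 0 ≤ ℰ.resistance p q := by
  refine Real.sSup_nonneg ?_
  rintro r ⟨f, -, rfl⟩
  exact div_nonneg (by positivity) (ℰ.nonneg f)

lemma eval_sub_eval_sq_le (f : ℰ.Pinned o) (p q : X) :
    (eval ℰ o p f - eval ℰ o q f) ^ 2 ≤ ℰ.resistance p q * ‖f‖ ^ 2 := by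
  rw [norm_sq_eq]
  exact ℰ.sq_sub_le (toDomain ℰ o f) p q

lemma abs_eval_le (f : ℰ.Pinned o) (x : X) :
    |eval ℰ o x f| ≤ √(ℰ.resistance x o) * ‖f‖ := by
  have h := eval_sub_eval_sq_le f x o
  rw [eval_base, sub_zero] at h
  rw [← Real.sqrt_sq (norm_nonneg f), ← Real.sqrt_mul (resistance_nonneg x o)]
  exact Real.abs_le_sqrt h

variable (ℰ o) in
/-- The reproducing kernel of the pinned functions. -/
def kernel (x : X) : ℰ.Pinned o :=
  (InnerProductSpace.toDual ℝ (ℰ.Pinned o)).symm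
    ((eval ℰ o x).mkContinuous (√(ℰ.resistance x o)) fun f => abs_eval_le f x)

lemma inner_kernel (x : X) (f : ℰ.Pinned o) : inner ℝ (kernel ℰ o x) f = eval ℰ o x f := by
  rw [kernel, InnerProductSpace.toDual_symm_apply]
  rfl

lemma kernel_base : kernel ℰ o o = 0 := by
  refine ext_inner_right ℝ fun f => ?_
  rw [inner_kernel, eval_base, inner_zero_left]

lemma norm_sq_kernel_sub (p q : X) : ‖kernel ℰ o p - kernel ℰ o q‖ ^ 2 = ℰ.resistance p q := by
  have hin : ∀ f : ℰ.Pinned o, inner ℝ (kernel ℰ o p - kernel ℰ o q) f =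
      eval ℰ o p f - eval ℰ o q f := fun f => by
    rw [inner_sub_left, inner_kernel, inner_kernel]
  set g := kernel ℰ o p - kernel ℰ o q
  refine le_antisymm ?_ (Real.sSup_le ?_ (by positivity))
  · have h := eval_sub_eval_sq_le g p q
    rw [← hin, real_inner_self_eq_norm_sq] at h
    by_cases h0 : ‖g‖ = 0
    · rw [h0]; simpa using resistance_nonneg p q
    · rw [sq (‖g‖ ^ 2)] at h
      exact le_of_mul_le_mul_right h (by positivity)
  · rintro r ⟨f, hf, rfl⟩
    rw [div_le_iff₀ (ℰ.form_pos hf), sq_abs, ← ℰ.norm_sq_pin (o := o), ← mul_pow]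
    have h := hin (ℰ.pin o f)
    rw [eval_pin, eval_pin, sub_sub_sub_cancel_right] at h
    rw [← h, ← sq_abs]
    gcongr
    exact abs_real_inner_le_norm _ _

lemma inner_kernel_kernel (x y : X) :
    inner ℝ (kernel ℰ o x) (kernel ℰ o y) = greenKernel ℰ.resistance o x y := by
  have h1 := norm_sq_kernel_sub (ℰ := ℰ) (o := o) x y
  have h2 := norm_sq_kernel_sub (ℰ := ℰ) (o := o) x o
  have h3 := norm_sq_kernel_sub (ℰ := ℰ) (o := o) y o
  rw [kernel_base, sub_zero] at h2 h3
  rw [norm_sub_sq_real] at h1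
  rw [greenKernel]
  linarith

lemma eval_sum_kernel {ι : Type*} (S : Finset ι) (w : ι → ℝ) (p : ι → X) (y : X) :
    eval ℰ o y (∑ i ∈ S, w i • kernel ℰ o (p i)) =
      ∑ i ∈ S, w i * greenKernel ℰ.resistance o (p i) y := by
  rw [← inner_kernel, inner_sum]
  refine Finset.sum_congr rfl fun i _ => ?_
  rw [real_inner_smul_right, real_inner_comm, inner_kernel_kernel]

lemma norm_sq_sum_kernel {ι : Type*} (S : Finset ι) (w : ι → ℝ) (p : ι → X) :
    ‖∑ i ∈ S, w i • kernel ℰ o (p i)‖ ^ 2 =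
      ∑ i ∈ S, ∑ j ∈ S, w i * w j * greenKernel ℰ.resistance o (p i) (p j) := by
  rw [← real_inner_self_eq_norm_sq, sum_inner]
  refine Finset.sum_congr rfl fun i _ => ?_
  rw [inner_sum]
  refine Finset.sum_congr rfl fun j _ => ?_
  rw [real_inner_smul_left, real_inner_smul_right, inner_kernel_kernel]
  ring

lemma span_kernel_dense :
    (Submodule.span ℝ (Set.range (kernel ℰ o))).topologicalClosure = ⊤ := by
  rw [Submodule.topologicalClosure_eq_top_iff, Submodule.eq_bot_iff]
  intro f hf
  refine ext_eval fun x => ?_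
  rw [map_zero, ← inner_kernel]
  exact (Submodule.mem_orthogonal _ f).1 hf _ (Submodule.subset_span ⟨x, rfl⟩)

/-- A function on which all kernel combinations are bounded in the dual sense is, up to a
constant, a pinned function. -/
lemma exists_eval_eq_of_forall_le (f : X → ℝ) {M : ℝ}
    (h : ∀ (S : Finset X) (w : X → ℝ), 2 * ∑ x ∈ S, w x * (f x - f o) -
      ‖∑ x ∈ S, w x • kernel ℰ o x‖ ^ 2 ≤ M) :
    ∃ g : ℰ.Pinned o, (∀ x, eval ℰ o x g = f x - f o) ∧ ‖g‖ ^ 2 ≤ M := by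
  have hM : 0 ≤ M := by simpa using h ∅ 0
  let T : (X →₀ ℝ) →ₗ[ℝ] ℰ.Pinned o := Finsupp.linearCombination ℝ (kernel ℰ o)
  let L : (X →₀ ℝ) →ₗ[ℝ] ℝ := Finsupp.linearCombination ℝ fun x => f x - f o
  have h1 : ∀ μ, 2 * L μ - ‖T μ‖ ^ 2 ≤ M := fun μ => h μ.support μ
  have h2 : ∀ μ, |L μ| ≤ √M * ‖T μ‖ := by
    intro μ
    have hd : ∀ t : ℝ, 0 ≤ ‖T μ‖ ^ 2 * (t * t) + (-(2 * L μ)) * t + M := fun t => by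
      have := h1 (t • μ)
      rw [map_smul, map_smul, norm_smul, mul_pow, Real.norm_eq_abs, sq_abs, smul_eq_mul] at this
      nlinarith
    have hd' := discrim_le_zero hd
    rw [discrim] at hd'
    rw [← Real.sqrt_sq (norm_nonneg (T μ)), ← Real.sqrt_mul hM]
    exact Real.abs_le_sqrt (by linarith)
  have hker : LinearMap.ker T ≤ LinearMap.ker L := fun μ hμ => by
    rw [LinearMap.mem_ker] at hμ ⊢
    have := h2 μ
    rw [hμ, norm_zero, mul_zero] at this
    exact abs_eq_zero.1 (le_antisymm this (abs_nonneg _))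
  let F : LinearMap.range T →ₗ[ℝ] ℝ :=
    (LinearMap.ker T).liftQ L hker ∘ₗ T.quotKerEquivRange.symm.toLinearMap
  have hF : ∀ μ, F ⟨T μ, LinearMap.mem_range_self T μ⟩ = L μ := fun μ => by
    have : T.quotKerEquivRange.symm ⟨T μ, LinearMap.mem_range_self T μ⟩ =
        (LinearMap.ker T).mkQ μ := T.quotKerEquivRange_symm_apply_image μ _
    simp [F, this]
  have hFb : ∀ v, ‖F v‖ ≤ √M * ‖v‖ := by
    rintro ⟨_, μ, rfl⟩
    rw [hF]
    exact h2 μ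
  obtain ⟨Φ, hΦ, hΦn⟩ := exists_extension_norm_eq (LinearMap.range T) (F.mkContinuous (√M) hFb)
  refine ⟨(InnerProductSpace.toDual ℝ (ℰ.Pinned o)).symm Φ, fun x => ?_, ?_⟩
  · rw [← inner_kernel, real_inner_comm, InnerProductSpace.toDual_symm_apply]
    have hT : T (Finsupp.single x 1) = kernel ℰ o x := by simp [T]
    have := (hΦ ⟨T (Finsupp.single x 1), LinearMap.mem_range_self T _⟩).trans
      (hF (Finsupp.single x 1))
    simpa [hT, L] using this
  · rw [LinearIsometryEquiv.norm_map, hΦn]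
    have hle := F.mkContinuous_norm_le (Real.sqrt_nonneg M) hFb
    conv_rhs => rw [← Real.sq_sqrt hM]
    gcongr

end Pinned

variable {ℰ}

lemma energy_of_mem {f : X → ℝ} (hf : f ∈ ℰ.domain) :
    ℰ.energy f = ENNReal.ofReal (ℰ.form ⟨f, hf⟩ ⟨f, hf⟩) := dif_pos hf

lemma mem_domain_of_energy_ne_top {f : X → ℝ} (hf : ℰ.energy f ≠ ⊤) : f ∈ ℰ.domain := by
  by_contra h
  exact hf (dif_neg h)

lemma energy_eq_of_eval_eq {f : X → ℝ} {g : ℰ.Pinned o} {a : ℝ}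
    (h : ∀ x, f x = a + Pinned.eval ℰ o x g) :
    ℰ.energy f = ENNReal.ofReal (‖g‖ ^ 2) := by
  have hf : f = fun x => ((Pinned.toDomain ℰ o g + ⟨fun _ => a, ℰ.const_mem a⟩ : ℰ.domain) :
      X → ℝ) x := by
    funext x
    rw [h, add_comm]
    rfl
  have hmem : f ∈ ℰ.domain := by rw [hf]; exact Subtype.coe_prop _
  rw [energy_of_mem hmem, Pinned.norm_sq_eq, ← ℰ.form_sub_const a ⟨f, hmem⟩]
  have : (⟨f, hmem⟩ - ⟨fun _ => a, ℰ.const_mem a⟩ : ℰ.domain) = Pinned.toDomain ℰ o g := by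
    refine Subtype.ext (funext fun x => ?_)
    change f x - a = Pinned.eval ℰ o x g
    rw [h]; ring
  rw [this]

variable {R : X → X → ℝ}

lemma IsAssociatedWith.resistance_eq (h : ℰ.IsAssociatedWith R) : ℰ.resistance = R :=
  funext₂ h

/-- Green potentials have energy given by the Green kernel. -/
lemma IsAssociatedWith.energy_potential (h : ℰ.IsAssociatedWith R) (o : X) {ι : Type*}
    (S : Finset ι) (w : ι → ℝ) (p : ι → X) (a : ℝ) :
    ℰ.energy (fun y => a + ∑ i ∈ S, w i * greenKernel R o (p i) y) =
      ENNReal.ofReal (∑ i ∈ S, ∑ j ∈ S, w i * w j * greenKernel R o (p i) (p j)) := by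
  rw [← h.resistance_eq, ← Pinned.norm_sq_sum_kernel]
  exact energy_eq_of_eval_eq fun x => by rw [Pinned.eval_sum_kernel]

/-- Lower bounds for the energy by duality with finite combinations of point masses. -/
lemma IsAssociatedWith.le_energy (h : ℰ.IsAssociatedWith R) (o : X) {ι : Type*}
    (S : Finset ι) (w : ι → ℝ) (p : ι → X) (f : X → ℝ) :
    ENNReal.ofReal (2 * ∑ i ∈ S, w i * (f (p i) - f o) -
      ∑ i ∈ S, ∑ j ∈ S, w i * w j * greenKernel R o (p i) (p j)) ≤ ℰ.energy f := by
  by_cases hf : ℰ.energy f = ⊤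
  · rw [hf]; exact le_top
  have hmem := mem_domain_of_energy_ne_top hf
  rw [energy_of_mem hmem, ← ℰ.norm_sq_pin (o := o), ← h.resistance_eq,
    ← Pinned.norm_sq_sum_kernel]
  refine ENNReal.ofReal_le_ofReal ?_
  set g := ℰ.pin o ⟨f, hmem⟩
  have : ∑ i ∈ S, w i * (f (p i) - f o) = inner ℝ (∑ i ∈ S, w i • Pinned.kernel ℰ o (p i)) g := by
    rw [sum_inner]
    refine Finset.sum_congr rfl fun i _ => ?_
    rw [real_inner_smul_left, Pinned.inner_kernel, eval_pin]
  rw [this]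
  nlinarith [norm_sub_sq_real (∑ i ∈ S, w i • Pinned.kernel ℰ o (p i)) g,
    sq_nonneg ‖∑ i ∈ S, w i • Pinned.kernel ℰ o (p i) - g‖]

/-- The dual lower bounds determine the energy. -/
lemma IsAssociatedWith.energy_le (h : ℰ.IsAssociatedWith R) (o : X) (f : X → ℝ) {M : ℝ≥0∞}
    (hM : ∀ (S : Finset X) (w : X → ℝ), ENNReal.ofReal (2 * ∑ x ∈ S, w x * (f x - f o) -
      ∑ x ∈ S, ∑ y ∈ S, w x * w y * greenKernel R o x y) ≤ M) : ℰ.energy f ≤ M := by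
  rcases eq_or_ne M ⊤ with rfl | hMtop
  · exact le_top
  obtain ⟨g, hg, hgn⟩ := Pinned.exists_eval_eq_of_forall_le (ℰ := ℰ) (o := o) f (M := M.toReal)
    fun S w => by
      have := hM S w
      rw [← h.resistance_eq, ← Pinned.norm_sq_sum_kernel S w fun x => x] at this
      exact (ENNReal.ofReal_le_iff_le_toReal hMtop).1 this
  rw [energy_eq_of_eval_eq (g := g) (a := f o) fun x => by rw [hg]; ring]
  exact ENNReal.ofReal_le_of_le_toReal hgn

/-- Functions of finite energy are approximated by Green potentials in energy. -/
lemma IsAssociatedWith.exists_potential (h : ℰ.IsAssociatedWith R) (o : X) {f : X → ℝ}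
    (hf : ℰ.energy f ≠ ⊤) {ε : ℝ} (hε : 0 < ε) :
    ∃ (S : Finset X) (w : X → ℝ),
      (∀ y, |f o + ∑ x ∈ S, w x * greenKernel R o x y - f y| ≤ √(R y o) * ε) ∧
      ENNReal.ofReal (∑ x ∈ S, ∑ y ∈ S, w x * w y * greenKernel R o x y) <
        ℰ.energy f + ENNReal.ofReal ε := by
  have hmem := mem_domain_of_energy_ne_top hf
  set g := ℰ.pin o ⟨f, hmem⟩ with hg
  have hgd : g ∈ closure (Submodule.span ℝ (Set.range (Pinned.kernel ℰ o)) :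
      Set (ℰ.Pinned o)) := by
    rw [← Submodule.topologicalClosure_coe, Pinned.span_kernel_dense]
    trivial
  have hU : {v : ℰ.Pinned o | ‖v - g‖ < ε ∧ ‖v‖ ^ 2 < ‖g‖ ^ 2 + ε} ∈ 𝓝 g := by
    refine IsOpen.mem_nhds ?_ ⟨by simpa using hε, by linarith⟩
    exact (isOpen_lt (f := fun v => ‖v - g‖) (g := fun _ => ε) (by fun_prop) (by fun_prop)).inter
      (isOpen_lt (f := fun v => ‖v‖ ^ 2) (g := fun _ => ‖g‖ ^ 2 + ε) (by fun_prop) (by fun_prop))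
  obtain ⟨v, ⟨hv1, hv2⟩, hv⟩ := mem_closure_iff_nhds.1 hgd _ hU
  obtain ⟨μ, rfl⟩ := (Finsupp.mem_span_range_iff_exists_finsupp).1 hv
  rw [Finsupp.sum] at hv1 hv2
  refine ⟨μ.support, μ, fun y => ?_, ?_⟩
  · have := Pinned.abs_eval_le (∑ x ∈ μ.support, μ x • Pinned.kernel ℰ o x - g) y
    rw [map_sub, Pinned.eval_sum_kernel _ _ fun x => x, hg, eval_pin, h.resistance_eq] at this
    refine le_trans (le_of_eq ?_) (this.trans ?_)
    · congr 1; simp only; ring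
    · gcongr
  · rw [Pinned.norm_sq_sum_kernel _ _ fun x => x, h.resistance_eq] at hv2
    rw [energy_of_mem hmem, ← ℰ.norm_sq_pin (o := o), ← ENNReal.ofReal_add (by positivity) hε.le]
    exact (ENNReal.ofReal_lt_ofReal_iff (by positivity)).2 hv2

end ResistanceForm

section HausdorffLimits

variable {B : Type*} [MetricSpace B] {A : ℕ → Set B} {Alim : Set B}

/-- Every point of a Hausdorff limit is a limit of points of the approximating sets. -/
lemma exists_section_tendsto [CompactSpace B] (hA : ∀ n, IsCompact (A n)) (hA_ne : ∀ n, (A n).Nonempty)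
    (hAlim_ne : Alim.Nonempty)
    (hA_lim : Tendsto (fun n => Metric.hausdorffDist (A n) Alim) atTop (𝓝 0)) :
    ∃ s : ∀ n, Alim → A n, ∀ x, Tendsto (fun n => (s n x : B)) atTop (𝓝 (x : B)) := by
  have h : ∀ n (x : Alim), ∃ y : A n, dist (y : B) x ≤ Metric.hausdorffDist (A n) Alim := by
    intro n x
    obtain ⟨y, hy, hxy⟩ := (hA n).exists_infDist_eq_dist (hA_ne n) (x : B)
    refine ⟨⟨y, hy⟩, ?_⟩
    rw [dist_comm, ← hxy, Metric.hausdorffDist_comm]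
    exact Metric.infDist_le_hausdorffDist_of_mem x.2
      (Metric.hausdorffEDist_ne_top_of_nonempty_of_bounded hAlim_ne (hA_ne n)
        (Bornology.IsBounded.all _) (Bornology.IsBounded.all _))
  choose s hs using h
  exact ⟨s, fun x => tendsto_iff_dist_tendsto_zero.2
    (squeeze_zero (fun _ => dist_nonneg) (fun n => hs n x) hA_lim)⟩

/-- A convergent selection along a subsequence extends to a convergent selection. -/
lemma exists_selection_extending {s : ∀ n, Alim → A n}
    (hs : ∀ x, Tendsto (fun n => (s n x : B)) atTop (𝓝 (x : B))) {σ : ℕ → ℕ} (hσ : StrictMono σ)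
    (z : ∀ k, A (σ k)) (x : Alim) (hz : Tendsto (fun k => (z k : B)) atTop (𝓝 (x : B))) :
    ∃ ys : ∀ n, A n, Tendsto (fun n => (ys n : B)) atTop (𝓝 (x : B)) ∧
      ∀ k, ys (σ k) = z k := by
  classical
  have key : ∀ n, ∃ y : A n, (∀ k (h : σ k = n), (y : B) = z k) ∧
      ((∃ k, σ k = n) ∨ y = s n x) := by
    intro n
    by_cases h : ∃ k, σ k = n
    · obtain ⟨k, rfl⟩ := h
      refine ⟨z k, fun j hj => ?_, Or.inl ⟨k, rfl⟩⟩
      rw [hσ.injective hj]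
    · exact ⟨s n x, fun k hk => absurd ⟨k, hk⟩ h, Or.inr rfl⟩
  choose ys hys hys' using key
  refine ⟨ys, ?_, fun k => Subtype.ext (hys _ k rfl)⟩
  rw [Metric.tendsto_atTop]
  intro ε hε
  obtain ⟨K, hK⟩ := Metric.tendsto_atTop.1 hz ε hε
  obtain ⟨N, hN⟩ := Metric.tendsto_atTop.1 (hs x) ε hε
  refine ⟨max (σ K) N, fun n hn => ?_⟩
  rcases hys' n with ⟨k, hk⟩ | hy
  · rw [hys n k hk]
    refine hK k (hσ.le_iff_le.1 ?_)
    rw [hk]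
    exact (le_max_left _ _).trans hn
  · rw [hy]
    exact hN n ((le_max_right _ _).trans hn)

/-- Selections along a subsequence accumulate on the Hausdorff limit. -/
lemma exists_subseq_tendsto_mem [CompactSpace B] (hA_ne : ∀ n, (A n).Nonempty)
    (hAlim : IsCompact Alim) (hAlim_ne : Alim.Nonempty)
    (hA_lim : Tendsto (fun n => Metric.hausdorffDist (A n) Alim) atTop (𝓝 0))
    {σ : ℕ → ℕ} (hσ : StrictMono σ) (z : ∀ k, A (σ k)) :
    ∃ (x : Alim) (τ : ℕ → ℕ), StrictMono τ ∧
      Tendsto (fun k => (z (τ k) : B)) atTop (𝓝 (x : B)) := by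
  obtain ⟨b, τ, hτ, hb⟩ := CompactSpace.tendsto_subseq fun k => (z k : B)
  have h1 : Tendsto (fun k => Metric.infDist (z (τ k) : B) Alim) atTop (𝓝 0) := by
    refine squeeze_zero (fun _ => Metric.infDist_nonneg) (fun k => ?_)
      (hA_lim.comp (hσ.tendsto_atTop.comp hτ.tendsto_atTop))
    exact Metric.infDist_le_hausdorffDist_of_mem (z (τ k)).2
      (Metric.hausdorffEDist_ne_top_of_nonempty_of_bounded (hA_ne _) hAlim_ne
        (Bornology.IsBounded.all _) (Bornology.IsBounded.all _))
  have h2 := tendsto_nhds_unique h1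
    (((Metric.continuous_infDist_pt Alim).tendsto b).comp hb)
  exact ⟨⟨b, (hAlim.isClosed.mem_iff_infDist_zero hAlim_ne).2 h2.symm⟩, τ, hτ, hb⟩

/-- Continuous convergence on compact sets preserves strict bounds uniformly. -/
lemma eventually_forall_abs_lt [CompactSpace B] (hA_ne : ∀ n, (A n).Nonempty)
    (hAlim : IsCompact Alim) (hAlim_ne : Alim.Nonempty)
    (hA_lim : Tendsto (fun n => Metric.hausdorffDist (A n) Alim) atTop (𝓝 0))
    {s : ∀ n, Alim → A n} (hs : ∀ x, Tendsto (fun n => (s n x : B)) atTop (𝓝 (x : B)))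
    {φ : ∀ n, A n → ℝ} {φlim : Alim → ℝ}
    (hφ : ∀ (x : Alim) (ys : ∀ n, A n), Tendsto (fun n => (ys n : B)) atTop (𝓝 (x : B)) →
      Tendsto (fun n => φ n (ys n)) atTop (𝓝 (φlim x)))
    {η : ℝ} (hη : ∀ x, |φlim x| < η) : ∀ᶠ n in atTop, ∀ y, |φ n y| < η := by
  by_contra hcon
  obtain ⟨σ, hσ, hbad⟩ := extraction_of_frequently_atTop (not_eventually.1 hcon)
  push Not at hbad
  choose z hz using hbad
  obtain ⟨x, τ, hτ, hx⟩ := exists_subseq_tendsto_mem hA_ne hAlim hAlim_ne hA_lim hσ z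
  obtain ⟨ys, hys, hyz⟩ := exists_selection_extending hs (hσ.comp hτ) (fun k => z (τ k)) x hx
  have h1 := ((hφ x ys hys).comp (hσ.comp hτ).tendsto_atTop).abs
  obtain ⟨k, hk⟩ := (h1.eventually_lt_const (hη x)).exists
  have h2 := hz (τ k)
  have h3 : ys (σ (τ k)) = z (τ k) := hyz k
  simp only [Function.comp_apply, h3] at hk
  exact absurd hk (not_lt.2 h2)

/-- A limit in the sense of `ConvergesTo` is continuous. -/
lemma ConvergesTo.continuous {R : ∀ n, A n → A n → ℝ} {Rlim : Alim → Alim → ℝ}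
    (hR : ConvergesTo R Rlim) {s : ∀ n, Alim → A n}
    (hs : ∀ x, Tendsto (fun n => (s n x : B)) atTop (𝓝 (x : B))) :
    Continuous fun p : Alim × Alim => Rlim p.1 p.2 := by
  refine continuous_iff_seqContinuous.2 fun u p hu => ?_
  have hev : ∀ k, ∀ᶠ n in atTop, dist (s n (u k).1 : B) (u k).1 < 1 / ((k : ℝ) + 1) ∧
      dist (s n (u k).2 : B) (u k).2 < 1 / ((k : ℝ) + 1) ∧
      dist (R n (s n (u k).1) (s n (u k).2)) (Rlim (u k).1 (u k).2) < 1 / ((k : ℝ) + 1) := by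
    intro k
    have hk : (0 : ℝ) < 1 / ((k : ℝ) + 1) := by positivity
    exact ((hs _).eventually (Metric.ball_mem_nhds _ hk)).and
      (((hs _).eventually (Metric.ball_mem_nhds _ hk)).and
        ((hR _ _ _ _ (hs _) (hs _)).eventually (Metric.ball_mem_nhds _ hk)))
  obtain ⟨σ, hσ, h⟩ := extraction_forall_of_eventually hev
  have h0 : Tendsto (fun k : ℕ => 1 / ((k : ℝ) + 1)) atTop (𝓝 0) :=
    tendsto_one_div_add_atTop_nhds_zero_nat
  have hclose : ∀ {E : Type _} [PseudoMetricSpace E] {a b : ℕ → E} {l : E},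
      (∀ k, dist (a k) (b k) < 1 / ((k : ℝ) + 1)) → Tendsto b atTop (𝓝 l) →
      Tendsto a atTop (𝓝 l) := fun hab hb =>
    (tendsto_iff_of_dist (squeeze_zero (fun _ => dist_nonneg) (fun k => (hab k).le) h0)).2 hb
  have hu' := Prod.tendsto_iff _ _ |>.1 hu
  obtain ⟨xs, hxs, hxz⟩ := exists_selection_extending hs hσ (fun k => s (σ k) (u k).1) p.1
    (hclose (fun k => (h k).1) ((continuous_subtype_val.tendsto _).comp hu'.1))
  obtain ⟨ys, hys, hyz⟩ := exists_selection_extending hs hσ (fun k => s (σ k) (u k).2) p.2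
    (hclose (fun k => (h k).2.1) ((continuous_subtype_val.tendsto _).comp hu'.2))
  have hlim := (hR _ _ xs ys hxs hys).comp hσ.tendsto_atTop
  simp only [Function.comp_def, hxz, hyz] at hlim
  exact (tendsto_iff_of_dist (squeeze_zero (fun _ => dist_nonneg)
    (fun k => (h k).2.2.le) h0)).1 hlim

/-- A metric that is a limit of resistance metrics is a resistance metric. -/
lemma ConvergesTo.isResistanceMetric {R : ∀ n, A n → A n → ℝ} {Rlim : Alim → Alim → ℝ}
    (hconv : ConvergesTo R Rlim) {s : ∀ n, Alim → A n}
    (hs : ∀ x, Tendsto (fun n => (s n x : B)) atTop (𝓝 (x : B)))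
    (hR : ∀ n, IsResistanceMetric (R n)) (hRlim : IsMetric Rlim) : IsResistanceMetric Rlim := by
  intro V
  have hpos : ∀ x y : V, x ≠ y → 0 < Rlim x y := fun x y hxy =>
    lt_of_le_of_ne (hRlim.nonneg _ _) fun h0 =>
      hxy (Subtype.ext ((hRlim.eq_zero_iff _ _).1 h0.symm))
  have hlim : ∀ x y : V, Tendsto (fun n => R n (s n x) (s n y)) atTop (𝓝 (Rlim x y)) :=
    fun x y => hconv _ _ _ _ (hs _) (hs _)
  have hinj : ∀ᶠ n in atTop, ∀ x y : V, x ≠ y → (s n x : B) ≠ s n y := by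
    refine eventually_all.2 fun x => eventually_all.2 fun y => ?_
    by_cases hxy : x = y
    · exact Eventually.of_forall fun n h => absurd hxy h
    · have : ((x : Alim) : B) ≠ (y : Alim) := fun h => hxy (Subtype.ext (Subtype.ext h))
      obtain ⟨U, W, hU, hW, hxU, hyW, hUW⟩ := t2_separation this
      filter_upwards [(hs x).eventually (hU.mem_nhds hxU), (hs y).eventually (hW.mem_nhds hyW)]
        with n h1 h2 _
      exact hUW.ne_of_mem h1 h2
  have hpos' : ∀ᶠ n in atTop, ∀ x y : V, x ≠ y → 0 < R n (s n x) (s n y) := by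
    refine eventually_all.2 fun x => eventually_all.2 fun y => ?_
    by_cases hxy : x = y
    · exact Eventually.of_forall fun n h => absurd hxy h
    · exact ((hlim x y).eventually_const_lt (hpos x y hxy)).mono fun n h _ => h
  have hex : ∀ n, ∃ c : V → V → ℝ, ((∀ x y : V, x ≠ y → (s n x : B) ≠ s n y) ∧
      ∀ x y : V, x ≠ y → 0 < R n (s n x) (s n y)) →
      IsEffectiveResistance c fun x y : V => R n (s n x) (s n y) := by
    intro n
    by_cases h : (∀ x y : V, x ≠ y → (s n x : B) ≠ s n y) ∧
        ∀ x y : V, x ≠ y → 0 < R n (s n x) (s n y)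
    · obtain ⟨c, hc⟩ := (hR n).exists_conductances (fun x : V => s n x)
        (fun x y hxy => by_contra fun hne => h.1 x y hne (congrArg Subtype.val hxy)) h.2
      exact ⟨c, fun _ => hc⟩
    · exact ⟨0, fun h' => absurd h' h⟩
  choose c hc using hex
  obtain ⟨c', hc'⟩ := exists_isEffectiveResistance_of_tendsto (ρ' := fun x y : V => Rlim x y)
    ((hinj.and hpos').mono fun n hn => hc n hn) hlim hpos
  exact ⟨dirichlet c', hc'.exists_form⟩

end HausdorffLimits

section GammaConvergence

variable {B : Type*} [MetricSpace B] {A : ℕ → Set B} {Alim : Set B}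

lemma ConvergesTo.tendsto_greenKernel {R : ∀ n, A n → A n → ℝ} {Rlim : Alim → Alim → ℝ}
    (hconv : ConvergesTo R Rlim) {o x y : Alim} {os xs ys : ∀ n, A n}
    (ho : Tendsto (fun n => (os n : B)) atTop (𝓝 (o : B)))
    (hx : Tendsto (fun n => (xs n : B)) atTop (𝓝 (x : B)))
    (hy : Tendsto (fun n => (ys n : B)) atTop (𝓝 (y : B))) :
    Tendsto (fun n => greenKernel (R n) (os n) (xs n) (ys n)) atTop
      (𝓝 (greenKernel Rlim o x y)) :=
  (((hconv _ _ _ _ hx ho).add (hconv _ _ _ _ hy ho)).sub (hconv _ _ _ _ hx hy)).div_const 2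

lemma ConvergesTo.tendsto_greenEnergy {R : ∀ n, A n → A n → ℝ} {Rlim : Alim → Alim → ℝ}
    (hconv : ConvergesTo R Rlim) {s : ∀ n, Alim → A n}
    (hs : ∀ x, Tendsto (fun n => (s n x : B)) atTop (𝓝 (x : B))) (o : Alim)
    (S : Finset Alim) (w : Alim → ℝ) :
    Tendsto (fun n => ∑ x ∈ S, ∑ y ∈ S, w x * w y * greenKernel (R n) (s n o) (s n x) (s n y))
      atTop (𝓝 (∑ x ∈ S, ∑ y ∈ S, w x * w y * greenKernel Rlim o x y)) :=
  tendsto_finsetSum _ fun x _ => tendsto_finsetSum _ fun y _ =>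
    (hconv.tendsto_greenKernel (hs o) (hs x) (hs y)).const_mul _

/-- Lower semicontinuity of the energies along uniformly convergent sequences. -/
lemma ConvergesTo.energy_le_liminf [CompactSpace B]
    {R : ∀ n, A n → A n → ℝ} {Rlim : Alim → Alim → ℝ}
    (hconv : ConvergesTo R Rlim) {s : ∀ n, Alim → A n}
    (hs : ∀ x, Tendsto (fun n => (s n x : B)) atTop (𝓝 (x : B))) (o : Alim)
    {ℰ : ∀ n, ResistanceForm (A n)} {ℰlim : ResistanceForm Alim}
    (hℰ : ∀ n, (ℰ n).IsAssociatedWith (R n)) (hℰlim : ℰlim.IsAssociatedWith Rlim)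
    (f : ℕ → C(B, ℝ)) (flim : C(B, ℝ)) (hf : Tendsto (fun n => ‖f n - flim‖) atTop (𝓝 0)) :
    ℰlim.energy (flim.restrict Alim) ≤
      liminf (fun n => (ℰ n).energy ((f n).restrict (A n))) atTop := by
  have hf' : Tendsto f atTop (𝓝 flim) := tendsto_iff_norm_sub_tendsto_zero.2 hf
  have hfs : ∀ x, Tendsto (fun n => f n (s n x)) atTop (𝓝 (flim x)) := fun x => hf'.eval (hs x)
  refine hℰlim.energy_le o _ fun S w => ?_
  have hlim : Tendsto (fun n => ENNReal.ofReal
      (2 * ∑ x ∈ S, w x * (f n (s n x) - f n (s n o)) -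
        ∑ x ∈ S, ∑ y ∈ S, w x * w y * greenKernel (R n) (s n o) (s n x) (s n y))) atTop
      (𝓝 (ENNReal.ofReal (2 * ∑ x ∈ S, w x * (flim x - flim o) -
        ∑ x ∈ S, ∑ y ∈ S, w x * w y * greenKernel Rlim o x y))) :=
    ENNReal.tendsto_ofReal (((tendsto_finsetSum _ fun x _ =>
      ((hfs x).sub (hfs o)).const_mul _).const_mul _).sub
        (hconv.tendsto_greenEnergy hs o S w))
  refine hlim.liminf_eq.symm.trans_le (liminf_le_liminf (Eventually.of_forall fun n => ?_))
  exact (hℰ n).le_energy (s n o) S w (fun x => s n x) ((f n).restrict (A n))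

lemma continuous_greenKernel {X : Type*} [TopologicalSpace X] {ρ : X → X → ℝ}
    (hρ : Continuous fun p : X × X => ρ p.1 p.2) (o x : X) :
    Continuous (greenKernel ρ o x) := by
  have h1 : Continuous fun y => ρ y o := hρ.comp (by fun_prop : Continuous fun y => (y, o))
  have h2 : Continuous fun y => ρ x y := hρ.comp (by fun_prop : Continuous fun y => (x, y))
  unfold greenKernel
  fun_prop

/-- A function of finite energy on the limit is uniformly close to functions whose energies on
the approximating sets are not much larger. -/
lemma ConvergesTo.eventually_exists_close [CompactSpace B]
    {R : ∀ n, A n → A n → ℝ} {Rlim : Alim → Alim → ℝ}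
    (hconv : ConvergesTo R Rlim) {s : ∀ n, Alim → A n}
    (hs : ∀ x, Tendsto (fun n => (s n x : B)) atTop (𝓝 (x : B))) (o : Alim)
    (hA : ∀ n, IsCompact (A n)) (hA_ne : ∀ n, (A n).Nonempty) (hAlim : IsCompact Alim)
    (hA_lim : Tendsto (fun n => Metric.hausdorffDist (A n) Alim) atTop (𝓝 0))
    (hR_cont : ∀ n, Continuous fun p : A n × A n => R n p.1 p.2)
    {ℰ : ∀ n, ResistanceForm (A n)} {ℰlim : ResistanceForm Alim}
    (hℰ : ∀ n, (ℰ n).IsAssociatedWith (R n)) (hℰlim : ℰlim.IsAssociatedWith Rlim)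
    (f : C(B, ℝ)) (hf : ℰlim.energy (f.restrict Alim) ≠ ⊤) {δ : ℝ} (hδ : 0 < δ) :
    ∀ᶠ n in atTop, ∃ g : C(B, ℝ), ‖g - f‖ ≤ δ ∧
      (ℰ n).energy (g.restrict (A n)) ≤
        ℰlim.energy (f.restrict Alim) + ENNReal.ofReal δ := by
  have hRc : Continuous fun y : Alim => √(Rlim y o) :=
    ((hconv.continuous hs).comp (by fun_prop : Continuous fun y : Alim => (y, o))).sqrt
  have := isCompact_iff_compactSpace.1 hAlim
  obtain ⟨C, hC⟩ := (isCompact_range hRc).bddAbove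
  have hC' : ∀ y : Alim, √(Rlim y o) ≤ C := fun y => hC ⟨y, rfl⟩
  have hC0 : 0 ≤ C := (Real.sqrt_nonneg _).trans (hC' o)
  obtain ⟨ε, hε, hεδ, hCε⟩ : ∃ ε > 0, ε ≤ δ ∧ C * ε < δ := by
    refine ⟨δ / (C + 1), by positivity, div_le_self hδ.le (by linarith), ?_⟩
    rw [mul_div_assoc', div_lt_iff₀ (by positivity)]
    nlinarith
  obtain ⟨S, w, hclose, henergy⟩ := hℰlim.exists_potential o hf hε
  have hunif := eventually_forall_abs_lt hA_ne hAlim ⟨o, o.2⟩ hA_lim hs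
    (φ := fun n y => f o + ∑ x ∈ S, w x * greenKernel (R n) (s n o) (s n x) y - f y)
    (φlim := fun y => f o + ∑ x ∈ S, w x * greenKernel Rlim o x y - f y)
    (fun y ys hys => ((tendsto_finsetSum _ fun x _ =>
      (hconv.tendsto_greenKernel (hs o) (hs x) hys).const_mul _).const_add _).sub
        ((f.continuous.tendsto _).comp hys))
    (fun y => (hclose y).trans_lt
      ((mul_le_mul_of_nonneg_right (hC' y) hε.le).trans_lt hCε))
  have hE := (ENNReal.tendsto_ofReal (hconv.tendsto_greenEnergy hs o S w)).eventually_lt_const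
    henergy
  filter_upwards [hunif, hE] with n hn hEn
  have := isCompact_iff_compactSpace.1 (hA n)
  let φ : C(A n, ℝ) :=
    ⟨fun y => f o + ∑ x ∈ S, w x * greenKernel (R n) (s n o) (s n x) y - f y, by
      have := fun x => continuous_greenKernel (hR_cont n) (s n o) x
      fun_prop⟩
  obtain ⟨ψ, hψ, hψφ⟩ := BoundedContinuousFunction.exists_extension_norm_eq_of_isClosedEmbedding
    (BoundedContinuousFunction.mkOfCompact φ) (hA n).isClosed.isClosedEmbedding_subtypeVal
  have hψ_eq : ∀ y : A n, ψ y = φ y := fun y => congrFun hψφ y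
  refine ⟨f + ψ.toContinuousMap, ?_, ?_⟩
  · rw [add_sub_cancel_left]
    refine (ContinuousMap.norm_le _ hδ.le).2 fun b => (ψ.norm_coe_le_norm b).trans ?_
    rw [hψ, BoundedContinuousFunction.norm_mkOfCompact, ContinuousMap.norm_le _ hδ.le]
    exact fun y => (hn y).le
  · have hg : ((f + ψ.toContinuousMap).restrict (A n) : A n → ℝ) =
        fun y => f o + ∑ x ∈ S, w x * greenKernel (R n) (s n o) (s n x) y := by
      funext y
      change f y + ψ y = _
      rw [hψ_eq]
      change f y + (f o + _ - f y) = _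
      ring
    rw [hg, (hℰ n).energy_potential (s n o) S w fun x => s n x]
    exact hEn.le.trans (by gcongr)

/-- A diagonal selection: if the infima of `F n` tend to zero, then `F n (f n)` tends to zero
for some choice of points `f n`. -/
lemma exists_seq_tendsto_zero {α : Type*} [Nonempty α] (F : ℕ → α → ℝ≥0∞)
    (h : ∀ δ : ℝ≥0∞, 0 < δ → ∀ᶠ n in atTop, ∃ a, F n a ≤ δ) :
    ∃ f : ℕ → α, Tendsto (fun n => F n (f n)) atTop (𝓝 0) := by
  have hex : ∀ n : ℕ, ∃ a, F n a ≤ (⨅ a, F n a) + ((n : ℝ≥0∞))⁻¹ := by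
    intro n
    by_cases htop : (⨅ a, F n a) = ⊤
    · exact ⟨Classical.arbitrary α, by rw [htop, top_add]; exact le_top⟩
    · obtain ⟨a, ha⟩ := iInf_lt_iff.1 (ENNReal.lt_add_right htop
        (ENNReal.inv_ne_zero.2 (ENNReal.natCast_ne_top n)))
      exact ⟨a, ha.le⟩
  choose f hf using hex
  refine ⟨f, tendsto_of_tendsto_of_tendsto_of_le_of_le tendsto_const_nhds ?_
    (fun _ => zero_le) hf⟩
  have h1 : Tendsto (fun n => ⨅ a, F n a) atTop (𝓝 0) :=
    ENNReal.tendsto_nhds_zero.2 fun δ hδ => (h δ hδ).mono fun n ⟨a, ha⟩ => iInf_le_of_le a ha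
  simpa using h1.add ENNReal.tendsto_inv_nat_nhds_zero

end GammaConvergence

end

theorem theorem2p13 {B : Type*} [MetricSpace B] [CompactSpace B]
    (A : ℕ → Set B) (Alim : Set B)
    (hA : ∀ n, IsCompact (A n)) (hA_ne : ∀ n, (A n).Nonempty)
    (hAlim : IsCompact Alim) (hAlim_ne : Alim.Nonempty)
    (hA_lim : Tendsto (fun n => Metric.hausdorffDist (A n) Alim) atTop (𝓝 0))
    (R : ∀ n, A n → A n → ℝ) (Rlim : Alim → Alim → ℝ)
    (hR : ∀ n, IsResistanceMetric (R n))
    (hR_cont : ∀ n, Continuous fun p : A n × A n => R n p.1 p.2)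
    (hRlim : IsMetric Rlim)
    (hR_lim : ConvergesTo R Rlim) :
    (IsResistanceMetric Rlim ∧ Continuous fun p : Alim × Alim => Rlim p.1 p.2) ∧
    ∀ (ℰ : ∀ n, ResistanceForm (A n)) (ℰlim : ResistanceForm Alim),
      (∀ n, (ℰ n).IsAssociatedWith (R n)) → ℰlim.IsAssociatedWith Rlim →
      GammaConverges (fun n (f : C(A n, ℝ)) => (ℰ n).energy f)
        (fun f : C(Alim, ℝ) => ℰlim.energy f) := by
  obtain ⟨s, hs⟩ := exists_section_tendsto hA hA_ne hAlim_ne hA_lim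
  obtain ⟨b, hb⟩ := hAlim_ne
  let o : Alim := ⟨b, hb⟩
  refine ⟨⟨hR_lim.isResistanceMetric hs hR hRlim, hR_lim.continuous hs⟩, ?_⟩
  intro ℰ ℰlim hℰ hℰlim
  have hliminf := hR_lim.energy_le_liminf hs o hℰ hℰlim
  refine ⟨hliminf, fun flim => ?_⟩
  by_cases htop : ℰlim.energy (flim.restrict Alim) = ⊤
  · have h0 : Tendsto (fun _ : ℕ => ‖flim - flim‖) atTop (𝓝 0) := by simp
    refine ⟨fun _ => flim, h0, tendsto_of_le_liminf_of_limsup_le (hliminf _ flim h0) ?_⟩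
    simp only [htop, le_top]
  obtain ⟨f, hf⟩ := exists_seq_tendsto_zero
    (fun n (g : C(B, ℝ)) => max (ENNReal.ofReal ‖g - flim‖)
      ((ℰ n).energy (g.restrict (A n)) - ℰlim.energy (flim.restrict Alim))) fun δ hδ => by
    obtain ⟨r, -, hr0, hr⟩ := ENNReal.lt_iff_exists_real_btwn.1 hδ
    filter_upwards [hR_lim.eventually_exists_close hs o hA hA_ne hAlim hA_lim hR_cont hℰ hℰlim
      flim htop (ENNReal.ofReal_pos.1 hr0)] with n hn
    obtain ⟨g, hg1, hg2⟩ := hn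
    exact ⟨g, max_le ((ENNReal.ofReal_le_ofReal hg1).trans hr.le)
      ((tsub_le_iff_left.2 hg2).trans hr.le)⟩
  have hf0 : Tendsto (fun n => ‖f n - flim‖) atTop (𝓝 0) := by
    have h1 : Tendsto (fun n => ENNReal.ofReal ‖f n - flim‖) atTop (𝓝 0) :=
      tendsto_of_tendsto_of_tendsto_of_le_of_le tendsto_const_nhds hf (fun _ => zero_le)
        fun _ => le_max_left _ _
    simpa [Function.comp_def] using (ENNReal.tendsto_toReal ENNReal.zero_ne_top).comp h1
  refine ⟨f, hf0, tendsto_of_le_liminf_of_limsup_le (hliminf f flim hf0) ?_⟩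
  have h2 := (tendsto_const_nhds (x := ℰlim.energy (flim.restrict Alim))).add hf
  rw [add_zero] at h2
  refine (limsup_le_limsup (Eventually.of_forall fun n => ?_)).trans_eq h2.limsup_eq
  exact tsub_le_iff_left.1 (le_max_right _ _)
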